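/- Let $d\ge 1$, $\gamma\in\mathbb R$, and let $Z$ be the dyadic branching Brownian motion in $\mathbb R^d$ with unit time branching and mean-field interaction of strength $\gamma$ (attraction for $\gamma>0$, repulsion for $\gamma<0$). That is, let $B^{m,i}$ ($m\ge 0$, $1\le i\le 2^m$) be independent standard $d$-dimensional Brownian motions started at the origin; $Z_0$ is a single particle at the origin; on each interval $[m,m+1)$ there are $2^m$ particles, which have continuous paths and solve $$Z^i_{m+\tau}=Z^i_m+B^{m,i}_\tau+\frac{\gamma}{2^m}\int_0^\tau\sum_{j=1}^{2^m}\bigl(Z^j_{m+s}-Z^i_{m+s}\bigr)\,\mathrm ds,\qquad 0\le\tau<1,\ 1\le i\le 2^m;$$ and at each integer time $m+1$ every particle is replaced by two children, which start at its position $\lim_{t\uparrow m+1}Z_t^i$. Put $n_t=2^{\lfloor t\rfloor}$ and let $\overline Z_t=\frac1{n_t}\sum_{i=1}^{n_t}Z^i_t$ be the center of mass. Then: (i) $\overline Z_t$ converges almost surely as $t\to\infty$ to a random vector $N$ with $N\sim\mathcal N(0,2I_d)$. (ii) Let $W^{(m)}_u=2^{-m}\sum_{i=1}^{2^m}B^{m,i}_{2^m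 u}$, $u\ge 0$, $m\ge 0$ (these processes do not involve $\gamma$). Then $W^{(0)},W^{(1)},\dots$ are independent standard $d$-dimensional Brownian motions, $W^{(m)}$ is independent of $(\overline Z_s)_{0\le s\le m}$ for every $m$, and almost surely $\overline Z_{m+\tau}=\overline Z_m+W^{(m)}_{\tau/2^m}$ for all $m\ge 0$ and $\tau\in[0,1]$. -/

import Mathlib

open MeasureTheory ProbabilityTheory Filter Topology
open scoped NNReal

/-- `W` is a standard Brownian motion in `ℝ^d` started at the origin: its coordinates are
independent real Brownian motions. -/
structure IsBrownianVec {d : ℕ} {Ω : Type*} [MeasurableSpace Ω]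
    (W : ℝ≥0 → Ω → EuclideanSpace ℝ (Fin d)) (P : Measure Ω) : Prop where
  coord : ∀ k : Fin d, IsBrownianReal (fun t ω => W t ω k) P
  indep : iIndepFun (fun (k : Fin d) (ω : Ω) (t : ℝ≥0) => W t ω k) P

/-- The number `n_t = 2 ^ ⌊t⌋` of particles alive at time `t`. -/
noncomputable def numParticles (t : ℝ≥0) : ℕ := 2 ^ ⌊t⌋₊

/-- The center of mass `(1 / n_t) ∑ i, Z i t` of the particles `Z i t`, `0 ≤ i < n_t`. -/
noncomputable def centerOfMass {d : ℕ} {Ω : Type*}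
    (Z : ℕ → ℝ≥0 → Ω → EuclideanSpace ℝ (Fin d)) (t : ℝ≥0) (ω : Ω) :
    EuclideanSpace ℝ (Fin d) :=
  (numParticles t : ℝ)⁻¹ • ∑ i ∈ Finset.range (numParticles t), Z i t ω

/-- `Z` is the dyadic branching Brownian motion in `ℝ^d` with unit time branching and mean-field
interaction of strength `γ` (attraction if `γ > 0`, repulsion if `γ < 0`), driven by the Brownian
motions `B m i`. Here `Z i t` is the position of particle `i` at time `t` and is meaningful for
`i < n_t` only; during `[m, m + 1)` there are `2 ^ m` particles, particle `i < 2 ^ m` is driven by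
`B m i`, and the two children of particle `i` have the labels `2 * i` and `2 * i + 1`. -/
structure IsSelfInteractingBBM {d : ℕ} {Ω : Type*} [MeasurableSpace Ω] (γ : ℝ)
    (Z : ℕ → ℝ≥0 → Ω → EuclideanSpace ℝ (Fin d))
    (B : ℕ → ℕ → ℝ≥0 → Ω → EuclideanSpace ℝ (Fin d)) (P : Measure Ω) : Prop where
  /-- Positions of living particles are random variables. -/
  measurable : ∀ (t : ℝ≥0) (i : ℕ), i < numParticles t → Measurable (Z i t)
  /-- The driving processes consist of random variables. -/
  measurable_driver : ∀ (m i : ℕ) (t : ℝ≥0), i < 2 ^ m → Measurable (B m i t)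
  /-- The driving processes are standard `d`-dimensional Brownian motions. -/
  brownian : ∀ m i : ℕ, i < 2 ^ m → IsBrownianVec (B m i) P
  /-- All driving Brownian motions, over all generations and particles, are independent. -/
  indep : iIndepFun (fun (p : {p : ℕ × ℕ // p.2 < 2 ^ p.1}) (ω : Ω) (t : ℝ≥0) =>
    B p.1.1 p.1.2 t ω) P
  /-- The process starts with a single particle at the origin. -/
  init : ∀ᵐ ω ∂P, Z 0 0 ω = 0
  /-- Particles move continuously between branching times. -/
  continuousOn : ∀ᵐ ω ∂P, ∀ m i : ℕ, i < 2 ^ m →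
    ContinuousOn (fun t => Z i t ω) (Set.Ico (m : ℝ≥0) (m + 1))
  /-- On `[m, m + 1)` the particles solve the interacting system of SDEs. -/
  sde : ∀ᵐ ω ∂P, ∀ m i : ℕ, i < 2 ^ m → ∀ τ : ℝ≥0, τ < 1 →
    Z i (m + τ) ω = Z i m ω + B m i τ ω
      + (γ / 2 ^ m) • ∫ s in (0 : ℝ)..τ, ∑ j ∈ Finset.range (2 ^ m),
          (Z j (m + s.toNNReal) ω - Z i (m + s.toNNReal) ω)
  /-- At time `m + 1` every particle starts where its parent was at time `(m + 1) - 0`. -/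
  branch : ∀ᵐ ω ∂P, ∀ m i : ℕ, i < 2 ^ (m + 1) →
    Tendsto (fun t => Z (i / 2) t ω) (𝓝[<] ((m : ℝ≥0) + 1)) (𝓝 (Z i ((m : ℝ≥0) + 1) ω))

/-- The process `u ↦ 2 ^ (-m) ∑ i, B m i (2 ^ m * u)`, built from the `2 ^ m` driving Brownian
motions of the time interval `[m, m + 1)` alone. -/
noncomputable def meanDriver {d : ℕ} {Ω : Type*}
    (B : ℕ → ℕ → ℝ≥0 → Ω → EuclideanSpace ℝ (Fin d)) (m : ℕ) (u : ℝ≥0) (ω : Ω) :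
    EuclideanSpace ℝ (Fin d) :=
  ((2 : ℝ) ^ m)⁻¹ • ∑ i ∈ Finset.range (2 ^ m), B m i (2 ^ m * u) ω

/-! The interaction terms are antisymmetric in the two particles, so they cancel in the sum, and
replacing every particle by two copies does not change the mean. Hence `γ` drops out: on `[m, m +
1]` the center of mass moves by the average of `2 ^ m` independent Brownian motions, which by
Brownian scaling is a Brownian motion `meanDriver B m` run up to time `2 ^ (-m)`
(`centerOfMass_add_of_le_one`, `isBrownianVec_meanDriver`). Generations use disjoint sets of
drivers, so these motions are independent, and the past up to time `m` is almost surely a function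
of the first `m` of them.

At integer times the center is thus a sum of independent Gaussians with covariances `2 ^ (-k) I`,
which add up to `2 I` in the limit; characteristic functions identify the law. Almost sure
convergence, also between integer times, comes from Doob's maximal inequality and Borel–Cantelli:
the suprema over the unit intervals are eventually below a geometric sequence. -/

/-- If `(X i j)` is a family of independent random variables indexed by pairs `(i, j)`, then the
families `(X i j)ⱼ` are independent. -/
lemma ProbabilityTheory.iIndepFun_curry {ι Ω : Type*} {κ : ι → Type*} {𝓧 : (i : ι) → κ i → Type*}
    [MeasurableSpace Ω] {P : Measure Ω} [∀ i j, MeasurableSpace (𝓧 i j)]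
    {X : (i : ι) → (j : κ i) → Ω → 𝓧 i j} (mX : ∀ i j, Measurable (X i j))
    (h : iIndepFun (fun (p : (i : ι) × κ i) ω ↦ X p.1 p.2 ω) P) :
    iIndepFun (fun i ω ↦ (X i · ω)) P := by
  have := h.isProbabilityMeasure
  have : ∀ i j, IsProbabilityMeasure (P.map (X i j)) :=
    fun i j ↦ Measure.isProbabilityMeasure_map (mX i j).aemeasurable
  have hX (i : ι) : P.map (fun ω ↦ (X i · ω)) = Measure.infinitePi fun j ↦ P.map (X i j) :=
    (iIndepFun_iff_map_fun_eq_infinitePi_map (by fun_prop)).1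
      (h.precomp (g := Sigma.mk i) sigma_mk_injective)
  have hc : (MeasurableEquiv.piCurry 𝓧) ∘ (fun ω p ↦ X p.1 p.2 ω) = fun ω i j ↦ X i j ω := by
    ext; simp [Sigma.curry]
  -- Independence means that the joint law is a product; currying turns the product over pairs into
  -- a product of products.
  rw [iIndepFun_iff_map_fun_eq_infinitePi_map (by fun_prop), ← hc,
    ← Measure.map_map (by fun_prop) (by fun_prop),
    (iIndepFun_iff_map_fun_eq_infinitePi_map (by fun_prop)).1 h,
    Measure.infinitePi_map_piCurry (fun i j ↦ P.map (X i j))]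
  simp_rw [hX]

/-- A weighted sum of independent pre-Brownian motions, with squared weights summing to one, is a
pre-Brownian motion. -/
lemma ProbabilityTheory.IsPreBrownianReal.weighted_sum {ι Ω : Type*} [Fintype ι]
    [MeasurableSpace Ω] {P : Measure Ω} {X : ι → ℝ≥0 → Ω → ℝ} (hX : ∀ i, IsPreBrownianReal (X i) P)
    (h : iIndepFun (fun i ω t ↦ X i t ω) P) (c : ι → ℝ) (hc : ∑ i, c i ^ 2 = 1) :
    IsPreBrownianReal (fun t ω ↦ ∑ i, c i * X i t ω) P := by
  classical
  have := h.isProbabilityMeasure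
  have hG (i : ι) : IsGaussianProcess (X i) P := IsPreBrownianReal.isGaussianProcess (hX i)
  have hL (i : ι) (t : ℝ≥0) : MemLp (fun ω ↦ c i * X i t ω) 2 P :=
    ((hG i).hasGaussianLaw_eval t).memLp_two.const_mul _
  refine IsGaussianProcess.isPreBrownianReal_of_covariance ⟨fun I ↦ ?_⟩ (fun t ↦ ?_)
    fun s t hst ↦ ?_
  · have hI : HasGaussianLaw (fun ω i ↦ I.restrict (X i · ω)) P :=
      iIndepFun.hasGaussianLaw (fun i ↦ (hG i).hasGaussianLaw I)
        (h.comp (fun _ x ↦ I.restrict x) fun _ ↦ by fun_prop)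
    let L : (ι → I → ℝ) →L[ℝ] (I → ℝ) := ∑ i, c i • ContinuousLinearMap.proj i
    have hsum : (fun ω ↦ I.restrict fun t ↦ ∑ i, c i * X i t ω) =
        L ∘ fun ω i ↦ I.restrict (X i · ω) := by
      ext ω t
      simp [L]
    exact hsum ▸ hI.map L
  · rw [integral_finsetSum _ fun i _ ↦ (hL i t).integrable (by norm_num)]
    refine Finset.sum_eq_zero fun i _ ↦ ?_
    rw [integral_const_mul, (hX i).integral_eval, mul_zero]
  · rw [covariance_fun_sum_fun_sum (fun i ↦ hL i s) (fun i ↦ hL i t)]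
    have hij (i j : ι) : cov[fun ω ↦ c i * X i s ω, fun ω ↦ c j * X j t ω; P] =
        if i = j then c i ^ 2 * s else 0 := by
      rw [covariance_const_mul_left, covariance_const_mul_right]
      split_ifs with hij
      · subst hij
        rw [(hX i).covariance_fun_eval, min_eq_left hst]
        ring
      · have hm (r : ℝ≥0) : Measurable fun x : ℝ≥0 → ℝ ↦ x r := measurable_pi_apply r
        have hI : IndepFun (fun ω ↦ X i s ω) (fun ω ↦ X j t ω) P :=
          (h.indepFun hij).comp (hm s) (hm t)
        have h0 : cov[fun ω ↦ X i s ω, fun ω ↦ X j t ω; P] = 0 := hI.covariance_eq_zero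
          ((hG i).hasGaussianLaw_eval s).memLp_two
          ((hG j).hasGaussianLaw_eval t).memLp_two
        rw [h0]
        simp
    simp [hij, ← Finset.sum_mul, hc]

/-! ### Doob's maximal inequality -/

/-- A pre-Brownian motion sampled along a grid is a martingale. -/
lemma ProbabilityTheory.IsPreBrownianReal.martingale_grid {Ω : Type*}
    [MeasurableSpace Ω] {P : Measure Ω} {X : ℝ≥0 → Ω → ℝ} (hX : IsPreBrownianReal X P)
    (mX : ∀ t, StronglyMeasurable (X t))
    (h : ℝ≥0) :
    Martingale (fun n : ℕ ↦ X (n * h)) (Filtration.natural (fun n : ℕ ↦ X (n * h))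
      fun _ ↦ mX _) P := by
  have := hX.isGaussianProcess.isProbabilityMeasure
  refine martingale_of_condExp_sub_eq_zero_nat (Filtration.stronglyAdapted_natural _)
    (fun n ↦ hX.integrable_eval _) fun n ↦ ?_
  have hind : IndepFun (X ((n + 1 : ℕ) * h) - X (n * h))
      (fun ω (j : Set.Iic n) ↦ X ((j : ℕ) * h) ω) P := by
    have hle (j : Set.Iic n) : ((j : ℕ) : ℝ≥0) * h ≤ n * h := by
      gcongr; exact j.2
    have hm : Measurable fun x : ℝ≥0 → ℝ ↦ x h := measurable_pi_apply h
    have hm' : Measurable fun (x : Set.Iic (n * h) → ℝ) (j : Set.Iic n) ↦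
        x ⟨(j : ℕ) * h, hle j⟩ := measurable_pi_lambda _ fun _ ↦ measurable_pi_apply _
    have hX1 : X ((n + 1 : ℕ) * h) - X (n * h) =
        (fun x : ℝ≥0 → ℝ ↦ x h) ∘ fun ω t ↦ X (n * h + t) ω - X (n * h) ω := by
      ext ω
      simp [add_mul]
    rw [hX1]
    exact (hX.indepFun_shift (n * h)).comp hm hm'
  refine (condExp_indep_eq (((mX _).measurable.sub (mX _).measurable).comap_le)
    (Filtration.le _ n) (comap_measurable _).stronglyMeasurable ?_).trans ?_
  · rw [Filtration.natural_eq_comap]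
    exact hind
  · simp only [Pi.sub_apply]
    rw [integral_sub (hX.integrable_eval _) (hX.integrable_eval _), hX.integral_eval,
      hX.integral_eval]
    simp
    rfl

/-- Nonnegativity of the variance of `|X t|` gives `(E|X t|)² ≤ E[(X t)²] = t`. -/
lemma ProbabilityTheory.IsPreBrownianReal.integral_abs_le_sqrt {Ω : Type*}
    [MeasurableSpace Ω] {P : Measure Ω} {X : ℝ≥0 → Ω → ℝ} (hX : IsPreBrownianReal X P) (t : ℝ≥0) :
    ∫ ω, |X t ω| ∂P ≤ √t := by
  have := hX.isGaussianProcess.isProbabilityMeasure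
  have hL := (hX.isGaussianProcess.hasGaussianLaw_eval t).memLp_two
  apply Real.le_sqrt_of_sq_le
  have h1 := variance_nonneg (fun ω ↦ |X t ω|) P
  have h2 : ∫ ω, X t ω ^ 2 ∂P = t := by
    have := (hX.hasLaw_eval t).variance_eq
    rw [variance_id_gaussianReal, variance_eq_sub hL, hX.integral_eval] at this
    simpa using this
  have hL' : MemLp (fun ω ↦ |X t ω|) 2 P := hL.abs
  rw [variance_eq_sub hL'] at h1
  simp only [Pi.pow_apply, sq_abs, h2] at h1
  linarith

/-- Doob's maximal inequality for a pre-Brownian motion along a grid. -/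
lemma ProbabilityTheory.IsPreBrownianReal.measure_grid_le {Ω : Type*}
    [MeasurableSpace Ω] {P : Measure Ω} {X : ℝ≥0 → Ω → ℝ} (hX : IsPreBrownianReal X P)
    (mX : ∀ t, StronglyMeasurable (X t))
    (h : ℝ≥0) (n : ℕ) {ε : ℝ≥0} (hε : ε ≠ 0) :
    P {ω | ∃ k : ℕ, k ≤ n ∧ ε ≤ |X (k * h) ω|} ≤ ENNReal.ofReal (√(n * h) / ε) := by
  have := hX.isGaussianProcess.isProbabilityMeasure
  have hM := hX.martingale_grid mX h
  -- `|M|` is written as `M ⊔ -M`, a supremum of two submartingales.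
  have hS := hM.submartingale.sup hM.neg.submartingale
  have key := maximal_ineq hS (fun k ω ↦ by simp [← abs_eq_max_neg]) (ε := ε) n
  have hset : {ω | ∃ k : ℕ, k ≤ n ∧ (ε : ℝ) ≤ |X (k * h) ω|} =
      {ω | (ε : ℝ) ≤ (Finset.range (n + 1)).sup'
      Finset.nonempty_range_add_one fun k ↦ ((fun n : ℕ ↦ X (n * h)) ⊔
        -(fun n : ℕ ↦ X (n * h))) k ω} := by
    ext ω
    simp [Finset.le_sup'_iff, abs_eq_max_neg]
  rw [← hset] at key
  have hint : ∫ ω in {ω | ∃ k : ℕ, k ≤ n ∧ (ε : ℝ) ≤ |X (k * h) ω|}, ((fun n : ℕ ↦ X (n * h)) ⊔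
        -(fun n : ℕ ↦ X (n * h))) n ω ∂P ≤ √(n * h) := by
    refine le_trans ?_ ((hX.integral_abs_le_sqrt (n * h)).trans_eq (by simp))
    refine (setIntegral_le_integral (hS.integrable n) (ae_of_all _ fun ω ↦ ?_)).trans_eq ?_
    · simp [← abs_eq_max_neg]
    · simp [← abs_eq_max_neg]
  rw [ENNReal.ofReal_div_of_pos (by positivity), ENNReal.le_div_iff_mul_le (by simp [hε]) (by simp),
    mul_comm, ENNReal.ofReal_coe_nnreal]
  exact key.trans (ENNReal.ofReal_le_ofReal hint)

/-- Doob's maximal inequality for Brownian motion. -/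
lemma ProbabilityTheory.IsBrownianReal.measure_exists_lt_abs_le {Ω : Type*}
    [MeasurableSpace Ω] {P : Measure Ω} {X : ℝ≥0 → Ω → ℝ} (hX : IsBrownianReal X P)
    (mX : ∀ t, StronglyMeasurable (X t))
    (T : ℝ≥0) {ε : ℝ≥0} (hε : ε ≠ 0) :
    P {ω | ∃ t ≤ T, ε < |X t ω|} ≤ ENNReal.ofReal (√T / ε) := by
  -- Dyadic grids are nested, so these events increase. The weak inequality is harmless: by
  -- continuity a strict exceedance at `t` persists at nearby grid points.
  let A (n : ℕ) : Set Ω := {ω | ∃ k : ℕ, k ≤ 2 ^ n ∧ ε ≤ |X (k * (T / 2 ^ n)) ω|}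
  have hA : Monotone A := by
    refine monotone_nat_of_le_succ fun n ω ↦ ?_
    rintro ⟨k, hk, hkε⟩
    refine ⟨2 * k, by rw [pow_succ]; lia, ?_⟩
    have hk2 : ((2 * k : ℕ) : ℝ≥0) * (T / 2 ^ (n + 1)) = k * (T / 2 ^ n) := by
      push_cast
      field_simp
      ring
    rwa [hk2]
  have hAn (n : ℕ) : P (A n) ≤ ENNReal.ofReal (√T / ε) := by
    have := hX.toIsPreBrownianReal.measure_grid_le mX (T / 2 ^ n) (2 ^ n) hε
    refine this.trans_eq ?_
    congr 3
    push_cast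
    field_simp
  have hU : P (⋃ n, A n) ≤ ENNReal.ofReal (√T / ε) := by
    rw [hA.measure_iUnion]
    exact iSup_le hAn
  refine (measure_mono_ae ?_).trans hU
  filter_upwards [hX.cont] with ω hω
  rintro ⟨t, htT, ht⟩
  obtain rfl | hT := eq_or_ne T 0
  · refine Set.mem_iUnion.2 ⟨0, 0, by simp, ?_⟩
    obtain rfl : t = 0 := by simpa using htT
    simpa using ht.le
  -- The last point of the `n`-th grid before `t`.
  let u (n : ℕ) : ℝ≥0 := ⌊t / T * 2 ^ n⌋₊ * (T / 2 ^ n)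
  have hu : Tendsto u atTop (𝓝 t) := by
    have h2 : Tendsto (fun n : ℕ ↦ ⌊t / T * 2 ^ n⌋₊ / (2 : ℝ≥0) ^ n) atTop (𝓝 (t / T)) := by
      rw [← NNReal.tendsto_coe]
      have := (tendsto_nat_floor_mul_div_atTop (R := ℝ) (a := (t / T : ℝ≥0)) (by positivity)).comp
        (tendsto_pow_atTop_atTop_of_one_lt (r := (2 : ℝ)) (by norm_num))
      refine this.congr fun n ↦ ?_
      have hf : ⌊((t / T * 2 ^ n : ℝ≥0) : ℝ)⌋₊ = ⌊t / T * 2 ^ n⌋₊ := Nonneg.nat_floor_coe _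
      push_cast at hf ⊢
      simp [hf]
    replace h2 := h2.mul_const T
    rw [div_mul_cancel₀ _ hT] at h2
    refine h2.congr fun n ↦ ?_
    simp only [u]
    ring
  have hev := ((hω.tendsto t).comp hu).abs.eventually (lt_mem_nhds ht)
  obtain ⟨n, hn⟩ := hev.exists
  refine Set.mem_iUnion.2 ⟨n, ⌊t / T * 2 ^ n⌋₊, ?_, hn.le⟩
  have : t / T ≤ 1 := div_le_one_of_le₀ htT zero_le
  refine Nat.floor_le_of_le ?_
  push_cast
  exact mul_le_of_le_one_left zero_le this

/-! ### Pathwise motion of the center of mass -/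

/-- In a mean-field system of integral equations the interaction terms cancel in the sum. -/
lemma sum_eq_of_mean_field {E : Type*} [NormedAddCommGroup E] [NormedSpace ℝ E] {ι : Type*}
    (S : Finset ι) (f b : ι → ℝ≥0 → E) (c : ℝ) {τ : ℝ≥0}
    (hf : ∀ i ∈ S, ContinuousOn (f i) (Set.Iic τ))
    (h : ∀ i ∈ S, f i τ = f i 0 + b i τ
      + c • ∫ s in (0 : ℝ)..τ, ∑ j ∈ S, (f j s.toNNReal - f i s.toNNReal)) :
    ∑ i ∈ S, f i τ = ∑ i ∈ S, f i 0 + ∑ i ∈ S, b i τ := by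
  have hc (i : ι) (hi : i ∈ S) :
      ContinuousOn (fun s : ℝ ↦ f i s.toNNReal) (Set.uIcc 0 (τ : ℝ)) := by
    refine (hf i hi).comp continuous_real_toNNReal.continuousOn fun s hs ↦ ?_
    rw [Set.uIcc_of_le (NNReal.coe_nonneg τ)] at hs
    exact Real.toNNReal_le_iff_le_coe.2 hs.2
  have h0 : ∑ i ∈ S, ∫ s in (0 : ℝ)..τ, ∑ j ∈ S, (f j s.toNNReal - f i s.toNNReal) = 0 := by
    rw [← intervalIntegral.integral_finsetSum fun i hi ↦ ?_]
    · simp [Finset.sum_sub_distrib, ← Finset.smul_sum]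
    · exact (continuousOn_finsetSum _ fun j hj ↦ (hc j hj).sub (hc i hi)).intervalIntegrable
  rw [Finset.sum_congr rfl h, Finset.sum_add_distrib, Finset.sum_add_distrib, ← Finset.smul_sum,
    h0, smul_zero, add_zero]

lemma sum_range_two_mul_div_two {E : Type*} [AddCommMonoid E] (f : ℕ → E) (n : ℕ) :
    ∑ i ∈ Finset.range (2 * n), f (i / 2) = 2 • ∑ i ∈ Finset.range n, f i := by
  induction n with
  | zero => simp
  | succ n ih =>
    rw [mul_add, mul_one, Finset.sum_range_succ, Finset.sum_range_succ, ih, Finset.sum_range_succ,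
      smul_add, two_smul ℕ (f n), add_assoc]
    congr <;> lia

lemma numParticles_natCast_add {m : ℕ} {τ : ℝ≥0} (hτ : τ < 1) : numParticles (m + τ) = 2 ^ m := by
  rw [numParticles, add_comm, Nat.floor_add_natCast zero_le, Nat.floor_eq_zero.2 hτ, zero_add]

lemma numParticles_natCast (m : ℕ) : numParticles m = 2 ^ m := by
  simp [numParticles]

section Path

variable {d : ℕ} {Ω : Type*} {γ : ℝ} {Z : ℕ → ℝ≥0 → Ω → EuclideanSpace ℝ (Fin d)}
  {B : ℕ → ℕ → ℝ≥0 → Ω → EuclideanSpace ℝ (Fin d)} {ω : Ω} {m : ℕ}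

lemma centerOfMass_add_of_lt_one
    (hc : ∀ i < 2 ^ m, ContinuousOn (fun t => Z i t ω) (Set.Ico (m : ℝ≥0) (m + 1)))
    (hs : ∀ i < 2 ^ m, ∀ τ : ℝ≥0, τ < 1 →
      Z i (m + τ) ω = Z i m ω + B m i τ ω
      + (γ / 2 ^ m) • ∫ s in (0 : ℝ)..τ, ∑ j ∈ Finset.range (2 ^ m),
          (Z j (m + s.toNNReal) ω - Z i (m + s.toNNReal) ω)) {τ : ℝ≥0} (hτ : τ < 1) :
    centerOfMass Z (m + τ) ω = centerOfMass Z m ω + meanDriver B m (τ / 2 ^ m) ω := by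
  have key := sum_eq_of_mean_field (Finset.range (2 ^ m)) (fun i t ↦ Z i (m + t) ω)
    (fun i t ↦ B m i t ω) (γ / 2 ^ m) (τ := τ) (fun i hi ↦ ?_) (fun i hi ↦ ?_)
  · have h2 : (2 : ℝ≥0) ^ m * (τ / 2 ^ m) = τ := mul_div_cancel₀ _ (by positivity)
    simp only [centerOfMass, meanDriver, numParticles_natCast_add hτ, numParticles_natCast, h2, key]
    simp [smul_add]
  · refine (hc i (by simpa using hi)).comp (by fun_prop) fun t ht ↦ ⟨by simp, ?_⟩
    gcongr
    exact lt_of_le_of_lt ht hτ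
  · simpa using hs i (by simpa using hi) τ hτ

/-- Only `τ = 1` is new: the branching condition makes the center left-continuous at `m + 1`, so the
formula for `τ < 1` passes to the limit. -/
lemma centerOfMass_add_of_le_one
    (hc : ∀ i < 2 ^ m, ContinuousOn (fun t => Z i t ω) (Set.Ico (m : ℝ≥0) (m + 1)))
    (hs : ∀ i < 2 ^ m, ∀ τ : ℝ≥0, τ < 1 →
      Z i (m + τ) ω = Z i m ω + B m i τ ω
      + (γ / 2 ^ m) • ∫ s in (0 : ℝ)..τ, ∑ j ∈ Finset.range (2 ^ m),
          (Z j (m + s.toNNReal) ω - Z i (m + s.toNNReal) ω))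
    (hb : ∀ i < 2 ^ (m + 1),
      Tendsto (fun t => Z (i / 2) t ω) (𝓝[<] ((m : ℝ≥0) + 1)) (𝓝 (Z i ((m : ℝ≥0) + 1) ω)))
    (hB : Continuous fun t ↦ meanDriver B m t ω) {τ : ℝ≥0} (hτ : τ ≤ 1) :
    centerOfMass Z (m + τ) ω = centerOfMass Z m ω + meanDriver B m (τ / 2 ^ m) ω := by
  obtain hτ | rfl := hτ.lt_or_eq
  · exact centerOfMass_add_of_lt_one hc hs hτ
  have : (𝓝[<] ((m : ℝ≥0) + 1)).NeBot := nhdsLT_neBot_of_exists_lt ⟨m, by simp⟩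
  have h1 : Tendsto (fun t ↦ centerOfMass Z t ω) (𝓝[<] ((m : ℝ≥0) + 1))
      (𝓝 (centerOfMass Z (m + 1) ω)) := by
    have h : Tendsto (fun t ↦ (2 ^ (m + 1) : ℝ)⁻¹ • ∑ i ∈ Finset.range (2 ^ (m + 1)), Z (i / 2) t ω)
        (𝓝[<] ((m : ℝ≥0) + 1))
        (𝓝 ((2 ^ (m + 1) : ℝ)⁻¹ • ∑ i ∈ Finset.range (2 ^ (m + 1)), Z i ((m : ℝ≥0) + 1) ω)) :=
      (tendsto_finsetSum _ fun i hi ↦ hb i (by simpa using hi)).const_smul _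
    have hn : numParticles ((m : ℝ≥0) + 1) = 2 ^ (m + 1) := by
      exact_mod_cast numParticles_natCast (m + 1)
    simp only [centerOfMass, hn, Nat.cast_pow, Nat.cast_ofNat]
    refine h.congr' ?_
    -- Before the branching there are `2 ^ m` particles; the sum over children counts each parent
    -- twice, which the halved prefactor compensates.
    filter_upwards [Ioo_mem_nhdsLT (show (m : ℝ≥0) < m + 1 by simp)] with t ht
    obtain ⟨τ, rfl⟩ := exists_add_of_le ht.1.le
    rw [numParticles_natCast_add (by simpa using ht.2), pow_succ' (2 : ℕ) m,
      sum_range_two_mul_div_two (fun i ↦ Z i (m + τ) ω), ← Nat.cast_smul_eq_nsmul ℝ, smul_smul]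
    congr 1
    push_cast
    rw [pow_succ']
    field_simp
  have h2 : Tendsto (fun t ↦ centerOfMass Z m ω + meanDriver B m ((t - m) / 2 ^ m) ω)
      (𝓝[<] ((m : ℝ≥0) + 1)) (𝓝 (centerOfMass Z m ω + meanDriver B m (1 / 2 ^ m) ω)) := by
    have : Continuous fun t : ℝ≥0 ↦
      centerOfMass Z m ω + meanDriver B m ((t - m) / 2 ^ m) ω := by fun_prop
    convert (this.tendsto (m + 1)).mono_left nhdsWithin_le_nhds using 3
    simp
  refine tendsto_nhds_unique h1 (h2.congr' ?_)
  filter_upwards [Ioo_mem_nhdsLT (show (m : ℝ≥0) < m + 1 by simp)] with t ht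
  obtain ⟨τ, rfl⟩ := exists_add_of_le ht.1.le
  rw [centerOfMass_add_of_lt_one hc hs (by simpa using ht.2)]
  simp

end Path

/-! ### Deterministic paths built from unit steps -/

section Recursion

variable {E : Type*} [NormedAddCommGroup E] {c : ℝ≥0 → E} {w : ℕ → ℝ≥0 → E}

/-- A path made of the increments `w k` over the unit intervals is the sum of these increments,
each stopped at the end of its interval. -/
lemma eq_sum_of_unit_steps (h0 : c 0 = 0)
    (h : ∀ (m : ℕ) (τ : ℝ≥0), τ ≤ 1 → c (m + τ) = c m + w m (τ / 2 ^ m)) (m : ℕ) {s : ℝ≥0}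
    (hs : s ≤ m) : c s = ∑ k ∈ Finset.range m, w k (min (s - k) 1 / 2 ^ k) := by
  induction m generalizing s with
  | zero =>
    obtain rfl : s = 0 := by simpa using hs
    simpa using h0
  | succ m ih =>
    rw [Finset.sum_range_succ]
    obtain hsm | hsm := le_total s m
    · have hw : w m 0 = 0 := by simpa using h m 0 zero_le
      rw [ih hsm, tsub_eq_zero_of_le hsm]
      simp [hw]
    · obtain ⟨τ, rfl⟩ := exists_add_of_le hsm
      have hτ : τ ≤ 1 := by simpa using hs
      rw [h m τ hτ, ih le_rfl, add_tsub_cancel_left, min_eq_left hτ]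
      congr 1
      refine Finset.sum_congr rfl fun k hk ↦ ?_
      have hk' : (1 : ℝ≥0) ≤ m - k := by
        rw [le_tsub_iff_left (by simpa using (Finset.mem_range.1 hk).le)]
        exact_mod_cast Finset.mem_range.1 hk
      rw [min_eq_right hk', min_eq_right (hk'.trans (tsub_le_tsub_right hsm _))]

/-- A path whose increments over the unit intervals have summable suprema converges. -/
lemma exists_tendsto_of_unit_steps [CompleteSpace E]
    (h : ∀ (m : ℕ) (τ : ℝ≥0), τ ≤ 1 → c (m + τ) = c m + w m (τ / 2 ^ m))
    {ε : ℕ → ℝ} (hε : Summable ε) (hw : ∀ᶠ m in atTop, ∀ t ≤ (2 ^ m)⁻¹, ‖w m t‖ ≤ ε m) :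
    ∃ x, Tendsto c atTop (𝓝 x) := by
  have hd : Summable fun n : ℕ ↦ dist (c (n : ℝ≥0)) (c (n.succ : ℕ)) := by
    refine hε.of_norm_bounded_eventually_nat ?_
    filter_upwards [hw] with m hm
    have := h m 1 le_rfl
    rw [Nat.cast_succ, this, dist_eq_norm]
    simpa using hm _ (by simp)
  obtain ⟨x, hx⟩ := cauchySeq_tendsto_of_complete (cauchySeq_of_summable_dist hd)
  refine ⟨x, ?_⟩
  have hfl : Tendsto (fun t : ℝ≥0 ↦ ⌊t⌋₊) atTop atTop := tendsto_nat_floor_atTop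
  -- The movement since the last integer time obeys the same bound, so convergence along the
  -- integers suffices.
  have hlim : Tendsto (fun t : ℝ≥0 ↦ w ⌊t⌋₊ ((t - ⌊t⌋₊) / 2 ^ ⌊t⌋₊)) atTop (𝓝 0) := by
    refine squeeze_zero_norm' ?_ (hε.tendsto_atTop_zero.comp hfl)
    filter_upwards [hfl.eventually hw] with t ht
    refine ht _ ?_
    rw [← one_div]
    gcongr
    exact tsub_le_iff_left.2 (Nat.lt_floor_add_one t).le
  rw [← add_zero x]
  refine ((hx.comp hfl).add hlim).congr fun t ↦ ?_
  have ht : (t - ⌊t⌋₊ : ℝ≥0) ≤ 1 := tsub_le_iff_left.2 (Nat.lt_floor_add_one t).le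
  have := h ⌊t⌋₊ _ ht
  rw [add_tsub_cancel_of_le (Nat.floor_le zero_le)] at this
  exact this.symm

end Recursion

/-! ### Averages of the drivers -/

section MeanDriver

variable {d : ℕ} {Ω : Type*}

lemma meanDriver_eq_sum_fin (B : ℕ → ℕ → ℝ≥0 → Ω → EuclideanSpace ℝ (Fin d)) (m : ℕ) (u : ℝ≥0)
    (ω : Ω) : meanDriver B m u ω = ((2 : ℝ) ^ m)⁻¹ • ∑ i : Fin (2 ^ m), B m i (2 ^ m * u) ω := by
  rw [meanDriver, Finset.sum_range]

lemma meanDriver_apply (B : ℕ → ℕ → ℝ≥0 → Ω → EuclideanSpace ℝ (Fin d)) (m : ℕ) (u : ℝ≥0)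
    (ω : Ω) (k : Fin d) :
    meanDriver B m u ω k = ((2 : ℝ) ^ m)⁻¹ * ∑ i : Fin (2 ^ m), B m i (2 ^ m * u) ω k := by
  simp [meanDriver_eq_sum_fin]

variable [MeasurableSpace Ω] {P : Measure Ω} {B : ℕ → ℕ → ℝ≥0 → Ω → EuclideanSpace ℝ (Fin d)}

lemma measurable_meanDriver {m : ℕ} (hB : ∀ (i : ℕ) (t : ℝ≥0), i < 2 ^ m → Measurable (B m i t))
    (u : ℝ≥0) : Measurable (meanDriver B m u) :=
  have h : Measurable fun ω ↦ ∑ i ∈ Finset.range (2 ^ m), B m i (2 ^ m * u) ω :=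
    Finset.measurable_fun_sum _ fun i hi ↦ hB i _ (Finset.mem_range.1 hi)
  h.const_smul ((2 : ℝ) ^ m)⁻¹

/-- The mean of the rescaled driving Brownian motions of one generation is a Brownian motion. -/
lemma isBrownianVec_meanDriver {m : ℕ}
    (mB : ∀ (i : ℕ) (t : ℝ≥0), i < 2 ^ m → Measurable (B m i t))
    (hB : ∀ i < 2 ^ m, IsBrownianVec (B m i) P)
    (hind : iIndepFun (fun (i : Fin (2 ^ m)) (ω : Ω) (t : ℝ≥0) => B m i t ω) P) :
    IsBrownianVec (meanDriver B m) P := by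
  have mB' (i : Fin (2 ^ m)) (k : Fin d) (t : ℝ≥0) : Measurable fun ω ↦ B m i t ω k :=
    (EuclideanSpace.proj (𝕜 := ℝ) k).continuous.measurable.comp (mB i t i.2)
  have hpair : iIndepFun (fun (p : Fin (2 ^ m) × Fin d) ω (t : ℝ≥0) ↦ B m p.1 t ω p.2) P := by
    refine iIndepFun_uncurry' (X := fun (i : Fin (2 ^ m)) (k : Fin d) ω (t : ℝ≥0) ↦ B m i t ω k)
      (fun i k ↦ measurable_pi_lambda _ (mB' i k)) ?_ fun i ↦ (hB i i.2).indep
    refine hind.comp (fun _ x (k : Fin d) (t : ℝ≥0) ↦ x t k) fun _ ↦ ?_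
    refine measurable_pi_lambda _ fun k ↦ measurable_pi_lambda _ fun t ↦ ?_
    exact (EuclideanSpace.proj (𝕜 := ℝ) k).continuous.measurable.comp (measurable_pi_apply t)
  refine ⟨fun k ↦ ⟨?_, ?_⟩, ?_⟩
  · have hk : iIndepFun (fun (i : Fin (2 ^ m)) ω (t : ℝ≥0) ↦ B m i t ω k) P :=
      hpair.precomp (g := fun i ↦ (i, k)) fun i j h ↦ (Prod.mk.inj h).1
    have hsq : ∑ _i : Fin (2 ^ m), ((√(2 ^ m))⁻¹ : ℝ) ^ 2 = 1 := by simp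
    have h1 : IsPreBrownianReal
        (fun t ω ↦ ∑ i : Fin (2 ^ m), (√(2 ^ m))⁻¹ * B m i t ω k) P :=
      IsPreBrownianReal.weighted_sum
        (fun i : Fin (2 ^ m) ↦ ((hB i i.2).coord k).toIsPreBrownianReal) hk
        (fun _ ↦ (√(2 ^ m))⁻¹) hsq
    -- One factor `(√(2 ^ m))⁻¹` normalizes the sum of `2 ^ m` Brownian motions, the other is the
    -- Brownian scaling for the time change `u ↦ 2 ^ m * u`.
    have heq : (fun u ω ↦ meanDriver B m u ω k) = fun u ω ↦ (√((2 ^ m : ℝ≥0) : ℝ))⁻¹ *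
        ∑ i : Fin (2 ^ m), (√(2 ^ m))⁻¹ * B m i (2 ^ m * u) ω k := by
      ext u ω
      rw [meanDriver_apply, ← Finset.mul_sum, ← mul_assoc]
      congr 1
      push_cast
      rw [← mul_inv, Real.mul_self_sqrt (by positivity)]
    rw [heq]
    exact h1.smul (pow_ne_zero m two_ne_zero)
  · have hc : ∀ᵐ ω ∂P, ∀ i : Fin (2 ^ m), Continuous fun t ↦ B m i t ω k :=
      ae_all_iff.2 fun i ↦ ((hB i i.2).coord k).cont
    filter_upwards [hc] with ω hω
    simp_rw [meanDriver_apply]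
    exact continuous_const.mul (continuous_finsetSum _ fun i _ ↦
      (hω i).comp (continuous_const.mul continuous_id))
  -- Regrouping the independent family by coordinate instead of by particle gives independent
  -- coordinates of the mean.
  · have hswap : iIndepFun (fun (p : (_ : Fin d) × Fin (2 ^ m)) ω (t : ℝ≥0) ↦ B m p.2 t ω p.1) P :=
      hpair.precomp (g := fun p : (_ : Fin d) × Fin (2 ^ m) ↦ (p.2, p.1)) fun p q h ↦ by
        obtain ⟨h1, h2⟩ := Prod.mk.inj h
        exact Sigma.ext h2 (heq_of_eq h1)
    have hcurry := iIndepFun_curry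
      (X := fun (k : Fin d) (i : Fin (2 ^ m)) ω (t : ℝ≥0) ↦ B m i t ω k)
      (fun k i ↦ measurable_pi_lambda _ (mB' i k)) hswap
    convert hcurry.comp (fun _ x (u : ℝ≥0) ↦ ((2 : ℝ) ^ m)⁻¹ * ∑ i, x i (2 ^ m * u))
      (fun _ ↦ ?_) using 4 with k ω u
    · exact meanDriver_apply B m u ω k
    · refine measurable_pi_lambda _ fun u ↦ (Finset.measurable_fun_sum _ fun i _ ↦ ?_).const_mul _
      exact (measurable_pi_apply _).comp (measurable_pi_apply i)

lemma iIndepFun_meanDriver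
    (mB : ∀ (m i : ℕ) (t : ℝ≥0), i < 2 ^ m → Measurable (B m i t))
    (hind : iIndepFun (fun (p : (m : ℕ) × Fin (2 ^ m)) (ω : Ω) (t : ℝ≥0) => B p.1 p.2 t ω) P) :
    iIndepFun (fun (m : ℕ) (ω : Ω) (u : ℝ≥0) => meanDriver B m u ω) P := by
  have hcurry := iIndepFun_curry
    (X := fun (m : ℕ) (i : Fin (2 ^ m)) ω (t : ℝ≥0) ↦ B m i t ω)
    (fun m i ↦ measurable_pi_lambda _ fun t ↦ mB m i t i.2) hind
  convert hcurry.comp (fun m x (u : ℝ≥0) ↦ ((2 : ℝ) ^ m)⁻¹ • ∑ i, x i (2 ^ m * u))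
    (fun m ↦ ?_) using 4 with m ω u
  · exact meanDriver_eq_sum_fin B m u ω
  · have h (u : ℝ≥0) : Measurable fun x : Fin (2 ^ m) → ℝ≥0 → EuclideanSpace ℝ (Fin d) ↦
        ∑ i, x i (2 ^ m * u) :=
      Finset.measurable_fun_sum _ fun i _ ↦ (measurable_pi_apply _).comp (measurable_pi_apply i)
    exact measurable_pi_lambda _ fun u ↦ (h u).const_smul ((2 : ℝ) ^ m)⁻¹

end MeanDriver

/-! ### Gaussian laws and small-time bounds -/

section BrownianVec

variable {d : ℕ} {Ω : Type*} [MeasurableSpace Ω] {P : Measure Ω}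

lemma IsBrownianVec.ae_continuous {W : ℝ≥0 → Ω → EuclideanSpace ℝ (Fin d)}
    (hW : IsBrownianVec W P) : ∀ᵐ ω ∂P, Continuous fun t ↦ W t ω := by
  filter_upwards [ae_all_iff.2 fun k ↦ (hW.coord k).cont] with ω hω
  exact (PiLp.continuous_toLp 2 _).comp (continuous_pi hω)

lemma IsBrownianVec.charFun_map {W : ℝ≥0 → Ω → EuclideanSpace ℝ (Fin d)}
    (hW : IsBrownianVec W P) (t : ℝ≥0) (x : EuclideanSpace ℝ (Fin d)) :
    charFun (P.map (W t)) x = Complex.exp (-(t * ‖x‖ ^ 2 / 2 : ℝ)) := by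
  have := hW.indep.isProbabilityMeasure
  have hind : iIndepFun (fun (k : Fin d) ω ↦ W t ω k) P :=
    hW.indep.comp (fun _ x ↦ x t) fun _ ↦ measurable_pi_apply t
  have h := (iIndepFun_iff_charFun_pi
    fun k ↦ (hW.coord k).toIsPreBrownianReal.aemeasurable t).1 hind x
  have hk (k : Fin d) : P.map (fun ω ↦ W t ω k) = gaussianReal 0 t :=
    ((hW.coord k).toIsPreBrownianReal.hasLaw_eval t).map_eq
  simp_rw [hk, charFun_gaussianReal, ← Complex.exp_sum] at h
  refine h.trans ?_
  congr 1
  rw [EuclideanSpace.real_norm_sq_eq, Finset.mul_sum, Finset.sum_div]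
  push_cast
  simp

lemma EuclideanSpace.norm_le_sum_abs (x : EuclideanSpace ℝ (Fin d)) : ‖x‖ ≤ ∑ k, |x k| := by
  rw [EuclideanSpace.norm_eq]
  apply Real.sqrt_le_left (Finset.sum_nonneg fun _ _ ↦ abs_nonneg _) |>.2
  simpa using Finset.sum_sq_le_sq_sum_of_nonneg (s := Finset.univ) (f := fun k ↦ |x k|)
    (fun _ _ ↦ abs_nonneg _)

/-- The suprema of Brownian motions over the time intervals `[0, 2 ^ (-m)]` decay geometrically. -/
lemma ae_eventually_norm_le_of_isBrownianVec {W : ℕ → ℝ≥0 → Ω → EuclideanSpace ℝ (Fin d)}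
    (hW : ∀ m, IsBrownianVec (W m) P) (mW : ∀ m t, Measurable (W m t)) :
    ∀ᵐ ω ∂P, ∀ᶠ m in atTop, ∀ t ≤ ((2 : ℝ≥0) ^ m)⁻¹, ‖W m t ω‖ ≤ d * (4 / 5 : ℝ) ^ m := by
  have hk (k : Fin d) : ∀ᵐ ω ∂P, ∀ᶠ m in atTop,
      ω ∉ {ω | ∃ t ≤ ((2 : ℝ≥0) ^ m)⁻¹, (((4 / 5) ^ m : ℝ≥0) : ℝ) < |W m t ω k|} := by
    refine ae_eventually_notMem (ne_top_of_le_ne_top ?_ (ENNReal.tsum_le_tsum fun m ↦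
      ((hW m).coord k).measure_exists_lt_abs_le (fun t ↦ ?_) ((2 ^ m)⁻¹) (ε := (4 / 5) ^ m)
        (by positivity)))
    -- Any ratio strictly between `1 / √2` and `1` could replace `4 / 5`. The comparison with `15 /
    -- 16` holds as `15 / 16 * (4 / 5) = 3 / 4` and `(3 / 4)² > 1 / 2`.
    · have hs : Summable fun m : ℕ ↦ √((2 ^ m)⁻¹ : ℝ≥0) / ((4 / 5) ^ m : ℝ≥0) := by
        refine Summable.of_nonneg_of_le (fun m ↦ by positivity) (fun m ↦ ?_)
          (summable_geometric_of_lt_one (r := (15 / 16 : ℝ)) (by norm_num) (by norm_num))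
        push_cast
        rw [div_le_iff₀ (by positivity), ← mul_pow]
        refine Real.sqrt_le_iff.2 ⟨by positivity, ?_⟩
        rw [← pow_mul, mul_comm m 2, pow_mul, ← inv_pow]
        gcongr
        norm_num
      rw [← ENNReal.ofReal_tsum_of_nonneg (fun m ↦ by positivity) hs]
      exact ENNReal.ofReal_ne_top
    · exact ((EuclideanSpace.proj (𝕜 := ℝ) k).continuous.measurable.comp
        (mW m t)).stronglyMeasurable
  filter_upwards [ae_all_iff.2 hk] with ω hω
  filter_upwards [eventually_all.2 hω] with m hm t ht
  refine (EuclideanSpace.norm_le_sum_abs _).trans ?_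
  refine (Finset.sum_le_sum (g := fun _ ↦ (4 / 5 : ℝ) ^ m) fun k _ ↦ ?_).trans (by simp)
  have := hm k
  simp only [not_exists, not_and, not_lt] at this
  simpa using this t ht

end BrownianVec

/-! ### Independence of the past, convergence and limit law -/

/-- If the increments of a random path over the unit intervals are independent Brownian motions
with slowed down time, then the increment over one interval is independent of the past. -/
lemma indepFun_past_of_unit_steps {d : ℕ} {Ω : Type*} [MeasurableSpace Ω] {P : Measure Ω}
    {c : ℝ≥0 → Ω → EuclideanSpace ℝ (Fin d)} {W : ℕ → ℝ≥0 → Ω → EuclideanSpace ℝ (Fin d)}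
    (mW : ∀ m t, Measurable (W m t))
    (hind : iIndepFun (fun (m : ℕ) (ω : Ω) (u : ℝ≥0) => W m u ω) P)
    (h0 : ∀ᵐ ω ∂P, c 0 ω = 0)
    (h : ∀ᵐ ω ∂P, ∀ (m : ℕ) (τ : ℝ≥0), τ ≤ 1 → c (m + τ) ω = c m ω + W m (τ / 2 ^ m) ω) (m : ℕ) :
    IndepFun (fun (ω : Ω) (u : ℝ≥0) => W m u ω)
      (fun (ω : Ω) (s : Set.Iic (m : ℝ≥0)) => c s ω) P := by
  -- Rebuilds the path up to time `m` from the first `m` increments, as in `eq_sum_of_unit_steps`.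
  let ψ (x : Finset.range m → ℝ≥0 → EuclideanSpace ℝ (Fin d)) (s : Set.Iic (m : ℝ≥0)) :
      EuclideanSpace ℝ (Fin d) := ∑ k, x k (min ((s : ℝ≥0) - (k : ℕ)) 1 / 2 ^ (k : ℕ))
  have hψ : Measurable ψ := measurable_pi_lambda _ fun s ↦
    Finset.measurable_fun_sum _ fun k _ ↦ (measurable_pi_apply _).comp (measurable_pi_apply k)
  have hφ : Measurable fun x : ({m} : Finset ℕ) → ℝ≥0 → EuclideanSpace ℝ (Fin d) ↦
      x ⟨m, Finset.mem_singleton_self m⟩ := measurable_pi_apply _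
  have key := (hind.indepFun_finset {m} (Finset.range m) (by simp)
    fun k ↦ measurable_pi_lambda _ (mW k)).comp hφ hψ
  refine IndepFun.process_congr_right (X := fun s ω ↦ ψ (fun k u ↦ W k u ω) s) key fun s ↦ ?_
  filter_upwards [h0, h] with ω hω0 hω
  rw [eq_sum_of_unit_steps (c := fun t ↦ c t ω) (w := fun k t ↦ W k t ω) hω0 hω m s.2]
  exact Finset.sum_coe_sort (Finset.range m) fun k ↦ W k (min ((s : ℝ≥0) - (k : ℕ)) 1 / 2 ^ k) ω

/-- If the increments of a random path over the unit intervals are independent Brownian motions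
run up to the times `2 ^ (-m)`, then the path converges almost surely. -/
lemma exists_ae_tendsto_of_unit_steps {d : ℕ} {Ω : Type*} [MeasurableSpace Ω] {P : Measure Ω}
    {c : ℝ≥0 → Ω → EuclideanSpace ℝ (Fin d)} {W : ℕ → ℝ≥0 → Ω → EuclideanSpace ℝ (Fin d)}
    (mW : ∀ m t, Measurable (W m t)) (hW : ∀ m, IsBrownianVec (W m) P)
    (h : ∀ᵐ ω ∂P, ∀ (m : ℕ) (τ : ℝ≥0), τ ≤ 1 → c (m + τ) ω = c m ω + W m (τ / 2 ^ m) ω) :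
    ∃ N : Ω → EuclideanSpace ℝ (Fin d), ∀ᵐ ω ∂P, Tendsto (fun t ↦ c t ω) atTop (𝓝 (N ω)) := by
  refine ⟨fun ω ↦ limUnder atTop fun t ↦ c t ω, ?_⟩
  filter_upwards [h, ae_eventually_norm_le_of_isBrownianVec hW mW] with ω hω hb
  exact tendsto_nhds_limUnder (exists_tendsto_of_unit_steps (c := fun t ↦ c t ω)
    (w := fun m t ↦ W m t ω) hω
    ((summable_geometric_of_lt_one (by norm_num) (by norm_num)).mul_left _) hb)

lemma charFun_multivariateGaussian_zero_smul_one {d : ℕ} {r : ℝ} (hr : 0 ≤ r)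
    (x : EuclideanSpace ℝ (Fin d)) :
    charFun (multivariateGaussian 0 (r • (1 : Matrix (Fin d) (Fin d) ℝ))) x
      = Complex.exp (-(r * ‖x‖ ^ 2 / 2 : ℝ)) := by
  rw [charFun_multivariateGaussian (Matrix.PosSemidef.one.smul hr)]
  congr 1
  rw [EuclideanSpace.real_norm_sq_eq]
  simp [Matrix.smul_mulVec, dotProduct, Finset.mul_sum, pow_two, mul_left_comm]

/-- The almost sure limit of a random path whose increments over the unit intervals are
independent Brownian motions run up to the times `2 ^ (-m)`. -/
lemma hasLaw_of_tendsto_of_unit_steps {d : ℕ} {Ω : Type*} [MeasurableSpace Ω] {P : Measure Ω}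
    {c : ℝ≥0 → Ω → EuclideanSpace ℝ (Fin d)} {W : ℕ → ℝ≥0 → Ω → EuclideanSpace ℝ (Fin d)}
    {N : Ω → EuclideanSpace ℝ (Fin d)}
    (mW : ∀ m t, Measurable (W m t)) (hW : ∀ m, IsBrownianVec (W m) P)
    (hind : iIndepFun (fun (m : ℕ) (ω : Ω) (u : ℝ≥0) => W m u ω) P)
    (h0 : ∀ᵐ ω ∂P, c 0 ω = 0)
    (h : ∀ᵐ ω ∂P, ∀ (m : ℕ) (τ : ℝ≥0), τ ≤ 1 → c (m + τ) ω = c m ω + W m (τ / 2 ^ m) ω)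
    (hN : ∀ᵐ ω ∂P, Tendsto (fun t ↦ c t ω) atTop (𝓝 (N ω))) :
    HasLaw N (multivariateGaussian 0 ((2 : ℝ) • (1 : Matrix (Fin d) (Fin d) ℝ))) P := by
  have := hind.isProbabilityMeasure
  let S (n : ℕ) (ω : Ω) : EuclideanSpace ℝ (Fin d) := ∑ k ∈ Finset.range n, W k (1 / 2 ^ k) ω
  have mS (n : ℕ) : Measurable (S n) := Finset.measurable_fun_sum _ fun k _ ↦ mW k _
  have hS : ∀ᵐ ω ∂P, Tendsto (fun n ↦ S n ω) atTop (𝓝 (N ω)) := by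
    filter_upwards [h0, h, hN] with ω hω0 hω hωN
    refine (hωN.comp tendsto_natCast_atTop_atTop).congr fun n ↦ ?_
    induction n with
    | zero => simpa [S] using hω0
    | succ n ih =>
      simp only [Function.comp_apply, S] at ih ⊢
      rw [Finset.sum_range_succ, ← ih, Nat.cast_succ, hω n 1 le_rfl]
  -- No measurability of `c` or `N` is assumed; it comes from the sums of increments.
  have mN : AEMeasurable N P :=
    aemeasurable_of_tendsto_metrizable_ae atTop (fun n ↦ (mS n).aemeasurable) hS
  refine ⟨mN, ?_⟩
  have := Measure.isProbabilityMeasure_map (μ := P) mN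
  refine Measure.ext_of_charFun (funext fun x ↦ ?_)
  have hcS (n : ℕ) : charFun (P.map (S n)) x =
      Complex.exp (-((∑ k ∈ Finset.range n, (1 / 2 : ℝ) ^ k) * ‖x‖ ^ 2 / 2 : ℝ)) := by
    have hI : iIndepFun (fun k ω ↦ W k (1 / 2 ^ k) ω) P :=
      hind.comp (fun k x ↦ x (1 / 2 ^ k)) fun k ↦ measurable_pi_apply _
    have hprod := iIndepFun.charFun_map_fun_finsetSum_eq_prod (s := Finset.range n)
      (fun k _ ↦ (mW k _).aemeasurable) (hI.restrict (Finset.range n))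
    have := congrFun hprod x
    simp only [S]
    rw [this, Finset.prod_apply]
    simp_rw [(hW _).charFun_map]
    rw [← Complex.exp_sum]
    congr 1
    push_cast
    simp [Finset.sum_mul, Finset.sum_div]
  have h1 : Tendsto (fun n ↦ charFun (P.map (S n)) x) atTop (𝓝 (charFun (P.map N) x)) := by
    simp_rw [charFun_apply]
    have hm : Continuous fun y : EuclideanSpace ℝ (Fin d) ↦
      Complex.exp (inner ℝ y x * Complex.I) := by fun_prop
    rw [integral_map mN hm.aestronglyMeasurable]
    simp_rw [fun n ↦ integral_map (mS n).aemeasurable (μ := P) hm.aestronglyMeasurable]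
    refine tendsto_integral_of_dominated_convergence (fun _ ↦ 1)
      (fun n ↦ (hm.measurable.comp (mS n)).aestronglyMeasurable) (integrable_const _)
      (fun n ↦ ae_of_all _ fun ω ↦ (Complex.norm_exp_ofReal_mul_I _).le) ?_
    filter_upwards [hS] with ω hω
    exact (hm.tendsto _).comp hω
  have h2 : Tendsto (fun n ↦ charFun (P.map (S n)) x) atTop
      (𝓝 (Complex.exp (-(2 * ‖x‖ ^ 2 / 2 : ℝ)))) := by
    simp_rw [hcS]
    -- The limiting variance: `∑ (1 / 2) ^ k = 2`.
    have hg := hasSum_geometric_two.tendsto_sum_nat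
    have hC : Continuous fun r : ℝ ↦ Complex.exp (-(r * ‖x‖ ^ 2 / 2 : ℝ)) := by fun_prop
    exact (hC.tendsto 2).comp hg
  rw [tendsto_nhds_unique h1 h2, charFun_multivariateGaussian_zero_smul_one zero_le_two]

lemma IsSelfInteractingBBM.iIndepFun_driver {d : ℕ} {Ω : Type*} [MeasurableSpace Ω]
    {P : Measure Ω} {γ : ℝ} {Z : ℕ → ℝ≥0 → Ω → EuclideanSpace ℝ (Fin d)}
    {B : ℕ → ℕ → ℝ≥0 → Ω → EuclideanSpace ℝ (Fin d)} (hZ : IsSelfInteractingBBM γ Z B P) :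
    iIndepFun (fun (p : (m : ℕ) × Fin (2 ^ m)) (ω : Ω) (t : ℝ≥0) => B p.1 p.2 t ω) P := by
  refine hZ.indep.precomp
    (g := fun p : (m : ℕ) × Fin (2 ^ m) ↦ ⟨(p.1, (p.2 : ℕ)), p.2.2⟩) ?_
  rintro ⟨m, i⟩ ⟨n, j⟩ h
  obtain ⟨rfl, h2⟩ := Prod.mk.inj (Subtype.mk.inj h)
  exact congrArg _ (Fin.ext h2)

/-- The center of mass converges almost surely to a limit with law `N(0, 2 I_d)`; on each unit
interval `[m, m + 1]` it moves as a Brownian motion slowed down by the factor `2 ^ (-m)`, which is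
independent of its past and does not depend on `γ`. -/
theorem lemma1 {d : ℕ} {Ω : Type*} [MeasurableSpace Ω] (P : Measure Ω) [IsProbabilityMeasure P]
    (γ : ℝ) (Z : ℕ → ℝ≥0 → Ω → EuclideanSpace ℝ (Fin d))
    (B : ℕ → ℕ → ℝ≥0 → Ω → EuclideanSpace ℝ (Fin d))
    (hZ : IsSelfInteractingBBM γ Z B P) :
    (∃ N : Ω → EuclideanSpace ℝ (Fin d),
      (∀ᵐ ω ∂P, Tendsto (fun t : ℝ≥0 => centerOfMass Z t ω) atTop (𝓝 (N ω))) ∧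
      HasLaw N (multivariateGaussian 0 ((2 : ℝ) • (1 : Matrix (Fin d) (Fin d) ℝ))) P) ∧
    (∀ᵐ ω ∂P, ∀ (m : ℕ) (τ : ℝ≥0), τ ≤ 1 →
      centerOfMass Z (m + τ) ω = centerOfMass Z m ω + meanDriver B m (τ / 2 ^ m) ω) ∧
    (∀ m : ℕ, IsBrownianVec (meanDriver B m) P) ∧
    iIndepFun (fun (m : ℕ) (ω : Ω) (u : ℝ≥0) => meanDriver B m u ω) P ∧
    (∀ m : ℕ, IndepFun (fun (ω : Ω) (u : ℝ≥0) => meanDriver B m u ω)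
      (fun (ω : Ω) (s : Set.Iic (m : ℝ≥0)) => centerOfMass Z s ω) P) := by
  have hind := hZ.iIndepFun_driver
  have mW (m : ℕ) (t : ℝ≥0) : Measurable (meanDriver B m t) :=
    measurable_meanDriver (hZ.measurable_driver m) t
  have hW (m : ℕ) : IsBrownianVec (meanDriver B m) P :=
    isBrownianVec_meanDriver (hZ.measurable_driver m) (hZ.brownian m)
      (hind.precomp (g := Sigma.mk m) sigma_mk_injective)
  have hWind := iIndepFun_meanDriver hZ.measurable_driver hind
  have h0 : ∀ᵐ ω ∂P, centerOfMass Z 0 ω = 0 := by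
    filter_upwards [hZ.init] with ω hω
    simp [centerOfMass, numParticles, hω]
  have hstep : ∀ᵐ ω ∂P, ∀ (m : ℕ) (τ : ℝ≥0), τ ≤ 1 →
      centerOfMass Z (m + τ) ω = centerOfMass Z m ω + meanDriver B m (τ / 2 ^ m) ω := by
    filter_upwards [hZ.continuousOn, hZ.sde, hZ.branch,
      ae_all_iff.2 fun m ↦ (hW m).ae_continuous] with ω hc hs hb hB m τ hτ
    exact centerOfMass_add_of_le_one (hc m) (hs m) (hb m) (hB m) hτ
  obtain ⟨N, hN⟩ := exists_ae_tendsto_of_unit_steps mW hW hstep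
  exact ⟨⟨N, hN, hasLaw_of_tendsto_of_unit_steps mW hW hWind h0 hstep hN⟩, hstep, hW, hWind,
    indepFun_past_of_unit_steps mW hWind h0 hstep⟩
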